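/- Let $b>1$ be real and put $q=e^{2\pi^{2}/\ln b}$. Then the series below converge and $$\sum_{n=1}^{\infty}\frac{b^{n}}{(1+b^{n})^{2}}-\frac{1}{2\ln b}=-\frac18+\frac{4\pi^{2}}{(\ln b)^{2}}\sum_{j=0}^{\infty}\frac{q^{2j+1}}{(q^{2j+1}-1)^{2}}.$$ Equivalently (setting $b=e^{2\pi a}$), for every real $a>0$ the series below converge and $$\sum_{j=1}^{\infty}\operatorname{sech}^{2}(j\pi a)-\frac{1}{a^{2}}\sum_{j=0}^{\infty}\operatorname{csch}^{2}\Bigl(\bigl(j+\tfrac12\bigr)\frac{\pi}{a}\Bigr)=\frac{1}{\pi a}-\frac12 ,$$ where $\operatorname{sech}x=1/\cosh x$ and $\operatorname{csch}x=1/\sinh x$. -/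

import Mathlib

/-! Let C(t) = ∑_{n≥1} csch²(nπt). As a Lambert series, C(t) is affinely related to the Eisenstein
series G₂(it), so the quasi-modularity of G₂ under z ↦ -1/z relates C(1/t) to C(t)
(`cschSqSeries_inv`). The sech² sum is C(a) - 4C(2a) and the half-integer csch² sum is C(1/(2a)) -
C(1/a); inverting at a and 2a cancels every C. -/

theorem Real.inv_sinh_sq_eq (x : ℝ) :
    (1 / Real.sinh x) ^ 2 = 4 * (Real.exp (-2 * x) / (1 - Real.exp (-2 * x)) ^ 2) := by
  by_cases hx : x = 0
  · simp [hx]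
  have h1 : Real.exp (-2 * x) = (Real.exp x)⁻¹ ^ 2 := by
    rw [← Real.exp_neg, ← Real.exp_nat_mul]; congr 1; push_cast; ring
  have h0 := Real.exp_pos x
  have hs : Real.sinh x ≠ 0 := by simpa [Real.sinh_eq_zero] using hx
  rw [h1]
  rw [Real.sinh_eq, Real.exp_neg] at hs ⊢
  generalize Real.exp x = y at *
  have hy : y ≠ 0 := h0.ne'
  have hs' : y - y⁻¹ ≠ 0 := fun h => hs (by rw [h]; simp)
  have e : (1 - y⁻¹ ^ 2) = y⁻¹ * (y - y⁻¹) := by field_simp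
  rw [e]
  field_simp
  norm_num

theorem Real.inv_cosh_sq_eq_sub {x : ℝ} (hx : x ≠ 0) :
    (1 / Real.cosh x) ^ 2 = (1 / Real.sinh x) ^ 2 - 4 * (1 / Real.sinh (2 * x)) ^ 2 := by
  have hs : Real.sinh x ≠ 0 := by simpa [Real.sinh_eq_zero] using hx
  have hc : Real.cosh x ≠ 0 := (Real.cosh_pos x).ne'
  rw [Real.sinh_two_mul]
  field_simp
  linarith [Real.cosh_sq x]

theorem Real.inv_sinh_sq_half_eq {y : ℝ} (hy : 0 < y) :
    y / (y - 1) ^ 2 = 1 / 4 * (1 / Real.sinh (Real.log y / 2)) ^ 2 := by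
  rw [Real.inv_sinh_sq_eq, show -2 * (Real.log y / 2) = -Real.log y by ring, Real.exp_neg,
    Real.exp_log hy]
  by_cases h : y = 1
  · simp [h]
  have h1 : y - 1 ≠ 0 := sub_ne_zero.2 h
  have e : 1 - y⁻¹ = y⁻¹ * (y - 1) := by field_simp
  rw [e]
  field_simp

theorem Real.inv_cosh_sq_half_eq {y : ℝ} (hy : 0 < y) :
    y / (1 + y) ^ 2 = 1 / 4 * (1 / Real.cosh (Real.log y / 2)) ^ 2 := by
  have h : (Real.cosh (Real.log y / 2)) ^ 2 = (1 + y) ^ 2 / (4 * y) := by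
    have h2 := Real.cosh_two_mul (Real.log y / 2)
    have h3 := Real.cosh_sq (Real.log y / 2)
    rw [show 2 * (Real.log y / 2) = Real.log y by ring, Real.cosh_log hy] at h2
    have h4 : (Real.cosh (Real.log y / 2)) ^ 2 = ((y + y⁻¹) / 2 + 1) / 2 := by linarith
    rw [h4]
    field_simp
    ring
  rw [div_pow, h]
  field_simp

theorem summable_inv_sinh_sq {x : ℝ} (hx : 0 < x) :
    Summable (fun n : ℕ => (1 / Real.sinh (((n : ℝ) + 1) * x)) ^ 2) := by
  have hr : Real.exp (-2 * x) < 1 := by rw [← Real.exp_zero]; exact Real.exp_lt_exp.2 (by linarith)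
  have hs := (summable_geometric_of_lt_one (Real.exp_pos _).le hr).mul_left
    (4 / (1 - Real.exp (-2 * x)) ^ 2)
  refine Summable.of_nonneg_of_le (fun n => by positivity) (fun n => ?_) hs
  rw [Real.inv_sinh_sq_eq, ← Real.exp_nat_mul, mul_div_assoc', div_mul_eq_mul_div]
  have h1 : Real.exp (-2 * ((n + 1) * x)) ≤ Real.exp (-2 * x) :=
    Real.exp_le_exp.2 (by nlinarith [mul_nonneg n.cast_nonneg hx.le])
  have h2 : Real.exp (-2 * ((n + 1) * x)) ≤ Real.exp (n * (-2 * x)) :=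
    Real.exp_le_exp.2 (by nlinarith)
  have h3 : 0 < 1 - Real.exp (-2 * x) := by linarith
  gcongr

/-- The series of `csch²` over the positive multiples of `π t`. -/
noncomputable def cschSqSeries (t : ℝ) : ℝ :=
  ∑' n : ℕ, (1 / Real.sinh (((n : ℝ) + 1) * (Real.pi * t))) ^ 2

/-- Expand x/(1-x)² = ∑ m xᵐ at x = q^d and group the terms by n = dm. -/
theorem tsum_sigma_one_mul_pow {q : ℂ} (hq : ‖q‖ < 1) :
    ∑' n : ℕ+, (ArithmeticFunction.sigma 1 n : ℂ) * q ^ (n : ℕ) =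
      ∑' n : ℕ, q ^ (n + 1) / (1 - q ^ (n + 1)) ^ 2 := by
  rw [← tsum_prod_pow_eq_tsum_sigma 1 hq,
    ← tsum_pnat_eq_tsum_succ (f := fun n : ℕ => q ^ n / (1 - q ^ n) ^ 2)]
  refine tsum_congr fun d => ?_
  have hd : ‖q ^ (d : ℕ)‖ < 1 := by
    rw [norm_pow]; exact pow_lt_one₀ (norm_nonneg _) hq d.ne_zero
  have h := hasSum_coe_mul_geometric_of_norm_lt_one hd
  rw [← h.tsum_eq, ← tsum_zero_pnat_eq_tsum_nat h.summable]
  simp [pow_mul]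

theorem EisensteinSeries.G2_I_mul {t : ℝ} (z : UpperHalfPlane)
    (hz : (z : ℂ) = Complex.I * t) :
    EisensteinSeries.G2 z =
      ((Real.pi ^ 2 / 3 - 2 * Real.pi ^ 2 * cschSqSeries t : ℝ) : ℂ) := by
  have hq : Complex.exp (2 * Real.pi * Complex.I * z) =
      ((Real.exp (-2 * (Real.pi * t)) : ℝ) : ℂ) := by
    rw [hz, Complex.ofReal_exp]
    congr 1
    push_cast
    linear_combination (2 * Real.pi * t : ℂ) * Complex.I_mul_I
  have hn : ‖Complex.exp (2 * Real.pi * Complex.I * z)‖ < 1 :=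
    UpperHalfPlane.norm_exp_two_pi_I_lt_one z
  have hL : cschSqSeries t = 4 * ∑' n : ℕ, Real.exp (-2 * (Real.pi * t)) ^ (n + 1) /
      (1 - Real.exp (-2 * (Real.pi * t)) ^ (n + 1)) ^ 2 := by
    rw [cschSqSeries, ← tsum_mul_left]
    refine tsum_congr fun n => ?_
    have e : -2 * (((n : ℝ) + 1) * (Real.pi * t)) = ((n + 1 : ℕ) : ℝ) * (-2 * (Real.pi * t)) := by
      push_cast; ring
    rw [Real.inv_sinh_sq_eq, ← Real.exp_nat_mul, e]
  rw [EisensteinSeries.G2_eq_tsum_cexp, tsum_sigma_one_mul_pow hn, hq, hL, riemannZeta_two]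
  push_cast
  ring

/-- The term t/π is the trace of the 1/z anomaly that keeps G₂ from being modular. -/
theorem cschSqSeries_inv {t : ℝ} (ht : 0 < t) :
    cschSqSeries t⁻¹ = 1 / 6 + t ^ 2 / 6 - t ^ 2 * cschSqSeries t - t / Real.pi := by
  let z : UpperHalfPlane := ⟨Complex.I * t, by simpa using ht⟩
  have hz : (z : ℂ) = Complex.I * t := rfl
  have ht' : (t : ℂ) ≠ 0 := by exact_mod_cast ht.ne'
  have hS : ((ModularGroup.S • z : UpperHalfPlane) : ℂ) = Complex.I * (t⁻¹ : ℝ) := by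
    rw [UpperHalfPlane.modular_S_smul]
    simp [hz, mul_comm]
  have h := EisensteinSeries.G2_S_transform z
  rw [EisensteinSeries.G2_I_mul z hz, EisensteinSeries.G2_I_mul _ hS, hz] at h
  have e1 : ((Complex.I * t) ^ 2)⁻¹ = ((-(t ^ 2)⁻¹ : ℝ) : ℂ) := by
    rw [mul_pow, Complex.I_sq]; push_cast; rw [neg_one_mul, inv_neg]
  have e2 : -2 * Real.pi * Complex.I / (Complex.I * t) = ((-(2 * Real.pi / t) : ℝ) : ℂ) := by
    push_cast; field_simp
  rw [e1, e2] at h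
  norm_cast at h
  have hp := Real.pi_pos
  field_simp at h ⊢
  linarith

theorem sech_csch_series {a : ℝ} (ha : 0 < a) :
    Summable (fun j : ℕ => (1 / Real.cosh (((j : ℝ) + 1) * Real.pi * a)) ^ 2) ∧
    Summable (fun j : ℕ => (1 / Real.sinh (((j : ℝ) + 1 / 2) * Real.pi / a)) ^ 2) ∧
    (∑' j : ℕ, (1 / Real.cosh (((j : ℝ) + 1) * Real.pi * a)) ^ 2) -
        1 / a ^ 2 * ∑' j : ℕ, (1 / Real.sinh (((j : ℝ) + 1 / 2) * Real.pi / a)) ^ 2 =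
      1 / (Real.pi * a) - 1 / 2 := by
  have hp := Real.pi_pos
  have hs : ∀ t : ℝ, 0 < t → HasSum
      (fun n : ℕ => (1 / Real.sinh (((n : ℝ) + 1) * (Real.pi * t))) ^ 2) (cschSqSeries t) :=
    fun t ht => (summable_inv_sinh_sq (mul_pos hp ht)).hasSum
  have hcosh : HasSum (fun j : ℕ => (1 / Real.cosh (((j : ℝ) + 1) * Real.pi * a)) ^ 2)
      (cschSqSeries a - 4 * cschSqSeries (2 * a)) := by
    refine ((hs a ha).sub ((hs (2 * a) (by positivity)).mul_left 4)).congr_fun fun j => ?_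
    rw [Real.inv_cosh_sq_eq_sub (by positivity)]
    ring_nf
  have hodd : Summable (fun j : ℕ => (1 / Real.sinh (((j : ℝ) + 1 / 2) * Real.pi / a)) ^ 2) := by
    refine ((hs (2 * a)⁻¹ (by positivity)).summable.comp_injective
      (mul_right_injective₀ (two_ne_zero (α := ℕ)))).congr fun j => ?_
    simp only [Function.comp]
    congr 3
    push_cast
    field_simp
  have hsplit : (∑' j : ℕ, (1 / Real.sinh (((j : ℝ) + 1 / 2) * Real.pi / a)) ^ 2) +
      cschSqSeries a⁻¹ = cschSqSeries (2 * a)⁻¹ := by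
    -- Index n carries the multiple n + 1 of π/(2a), so even indices give the half-integer multiples
    -- of π/a and odd ones the integer multiples.
    refine (HasSum.even_add_odd
      (f := fun n : ℕ => (1 / Real.sinh (((n : ℝ) + 1) * (Real.pi * (2 * a)⁻¹))) ^ 2)
      (hodd.hasSum.congr_fun fun j => ?_)
      ((hs a⁻¹ (by positivity)).congr_fun fun j => ?_)).unique (hs _ (by positivity))
    · congr 3
      push_cast
      field_simp
    · congr 3
      push_cast
      field_simp
      ring
  refine ⟨hcosh.summable, hodd, ?_⟩
  rw [hcosh.tsum_eq, eq_sub_of_add_eq hsplit, cschSqSeries_inv ha,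
    cschSqSeries_inv (t := 2 * a) (by positivity)]
  field_simp
  ring

theorem mainTheorem10 :
    (∀ b q : ℝ, 1 < b → q = Real.exp (2 * Real.pi ^ 2 / Real.log b) →
      Summable (fun n : ℕ => b ^ (n + 1) / (1 + b ^ (n + 1)) ^ 2) ∧
      Summable (fun j : ℕ => q ^ (2 * j + 1) / (q ^ (2 * j + 1) - 1) ^ 2) ∧
      (∑' n : ℕ, b ^ (n + 1) / (1 + b ^ (n + 1)) ^ 2) - 1 / (2 * Real.log b) =
        -(1 / 8) + 4 * Real.pi ^ 2 / Real.log b ^ 2 *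
          ∑' j : ℕ, q ^ (2 * j + 1) / (q ^ (2 * j + 1) - 1) ^ 2) ∧
    (∀ a : ℝ, 0 < a →
      Summable (fun j : ℕ => (1 / Real.cosh (((j : ℝ) + 1) * Real.pi * a)) ^ 2) ∧
      Summable (fun j : ℕ => (1 / Real.sinh (((j : ℝ) + 1 / 2) * Real.pi / a)) ^ 2) ∧
      (∑' j : ℕ, (1 / Real.cosh (((j : ℝ) + 1) * Real.pi * a)) ^ 2) -
          1 / a ^ 2 * ∑' j : ℕ, (1 / Real.sinh (((j : ℝ) + 1 / 2) * Real.pi / a)) ^ 2 =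
        1 / (Real.pi * a) - 1 / 2) := by
  refine ⟨fun b q hb hq => ?_, fun a ha => sech_csch_series ha⟩
  have hp := Real.pi_pos
  have hl : 0 < Real.log b := Real.log_pos hb
  have hb0 : 0 < b := by linarith
  -- This a solves b = e^{2πa}, whence q = e^{π/a}.
  obtain ⟨h1, h2, h3⟩ := sech_csch_series (a := Real.log b / (2 * Real.pi)) (by positivity)
  have hc : ∀ n : ℕ, b ^ (n + 1) / (1 + b ^ (n + 1)) ^ 2 = 1 / 4 *
      (1 / Real.cosh (((n : ℝ) + 1) * Real.pi * (Real.log b / (2 * Real.pi)))) ^ 2 := fun n => by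
    rw [Real.inv_cosh_sq_half_eq (pow_pos hb0 _), Real.log_pow]
    congr 4
    push_cast
    field_simp
  have hs : ∀ j : ℕ, q ^ (2 * j + 1) / (q ^ (2 * j + 1) - 1) ^ 2 = 1 / 4 *
      (1 / Real.sinh (((j : ℝ) + 1 / 2) * Real.pi / (Real.log b / (2 * Real.pi)))) ^ 2 :=
    fun j => by
      have hq0 : 0 < q := hq ▸ Real.exp_pos _
      rw [Real.inv_sinh_sq_half_eq (pow_pos hq0 _), Real.log_pow, hq, Real.log_exp]
      congr 4
      push_cast
      field_simp
  simp only [hc, hs, tsum_mul_left]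
  refine ⟨h1.mul_left _, h2.mul_left _, ?_⟩
  rw [sub_eq_iff_eq_add.1 h3]
  field_simp
  ring
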